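/- Let $n\ge 1$. Call a real $n\times n$ matrix a \emph{Jacobi matrix} if it is symmetric, tridiagonal and has pairwise distinct eigenvalues, and let $\mathrm{Jac}_0(n)$ be the set of all $n\times n$ Jacobi matrices with zero diagonal. For real numbers $a_1,\dots,a_{n-1}$ let $D_1(a_1,\dots,a_{n-1})$ be the symmetric tridiagonal matrix with zero diagonal and with super-diagonal (and sub-diagonal) $a_1,\dots,a_{n-1}$. For $H$ with super-diagonal $a_1,\dots,a_{n-1}$ let $K(H)$ be the skew-symmetric matrix whose second super-diagonal is $a_1a_2,a_2a_3,\dots,a_{n-2}a_{n-1}$, whose second sub-diagonal is the negative of that, and all of whose other entries are $0$. For $H_0\in\mathrm{Jac}_0(n)$ let $M(H_0)$ be the set of all $H\in\mathrm{Jac}_0(n)$ with the same eigenvalues as $H_0$. Consider, with $[A,B]=AB-BA$, the matrix differential equation $$\frac{d}{dt}H(t)=[H(t),K(H(t))],\qquad H(0)=H_0\in\mathrm{Jac}_0(n).\tag{$*$}$$ (i) $(*)$ defines an isospectral flow on $\mathrm{Jac}_0(n)$: there is a continuous flow $\varphi:\mathbb R\times \mathrm{Jac}_0(n)\to\mathrm{Jac}_0(n)$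 such that for every $H_0\in\mathrm{Jac}_0(n)$ the curve $t\mapsto\varphi_t(H_0)$ solves $(*)$ and has constant spectrum, and every matrix-valued solution of $(*)$ on an interval containing $0$ agrees there with $t\mapsto\varphi_t(H_0)$. (ii) For every $H_0\in\mathrm{Jac}_0(n)$ the solution $H(t)$ of $(*)$ exists for all $t\ge 0$ and, as $t\to\infty$, approaches (its distance in the Frobenius norm tends to $0$) the set of equilibrium points of $(*)$ in $M(H_0)$, which is nonempty and is given by $\{\bar H\in M(H_0) : K(\bar H)=0\}$. (iii) $\lim_{t\to\infty}H(t)$ exists for every $H_0\in\mathrm{Jac}_0(n)$. (iv) Let $H_0=D_1(a_1,\dots,a_{n-1})\in\mathrm{Jac}_0(n)$ with $a_i\neq 0$ for all $2\le i\le n-1$. If $n$ is even, then the spectrum of $H_0$ has the form $\{\pm\lambda_1,\dots,\pm\lambda_{n/2}\}$ with $|\lambda_1|<|\lambda_2|<\dots<|\lambda_{n/2}|$, and for any such $\lambda_k$ the solution $H(t)$ of $(*)$ satisfies $$\lim_{t\to\infty}H(t)=D_1\bigl(\operatorname{sgn}(a_1)|\lambda_1|,\,0,\,\operatorname{sgn}(a_3)|\lambda_2|,\,0,\dots,\operatorname{sgn}(a_{n-1})|\lambda_{n/2}|\bigr).$$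 If $n$ is odd, then the spectrum of $H_0$ has the form $\{0,\pm\lambda_1,\dots,\pm\lambda_{(n-1)/2}\}$ with $0<|\lambda_1|<|\lambda_2|<\dots<|\lambda_{(n-1)/2}|$, and for any such $\lambda_k$ the solution $H(t)$ of $(*)$ satisfies $$\lim_{t\to\infty}H(t)=D_1\bigl(0,\,\operatorname{sgn}(a_2)|\lambda_1|,\,0,\,\operatorname{sgn}(a_4)|\lambda_2|,\,0,\dots,\operatorname{sgn}(a_{n-1})|\lambda_{(n-1)/2}|\bigr).$$ -/

import Mathlib

open Set Filter Topology

/-- The `n × n` matrix with `a 1, a 2, …, a (n - p)` on the `p`-th super-diagonal and zeros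
elsewhere.  Sequences are indexed from `1`: the entry in (one-based) row `i` is `a i`. -/
def superDiag (n p : ℕ) (a : ℕ → ℝ) : Matrix (Fin n) (Fin n) ℝ :=
  Matrix.of fun i j => if (j : ℕ) = (i : ℕ) + p then a ((i : ℕ) + 1) else 0

/-- The symmetric matrix with `a 1, …, a (n - p)` on the `p`-th super- and sub-diagonal. -/
def symDiag (n p : ℕ) (a : ℕ → ℝ) : Matrix (Fin n) (Fin n) ℝ :=
  superDiag n p a + (superDiag n p a).transpose

/-- The `i`-th entry (`1 ≤ i ≤ n - 1`, one-based) of the first super-diagonal of `H`. -/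
def superEntry {n : ℕ} (H : Matrix (Fin n) (Fin n) ℝ) (i : ℕ) : ℝ :=
  if h : 1 ≤ i ∧ i < n then H ⟨i - 1, by omega⟩ ⟨i, h.2⟩ else 0

/-- The skew-symmetric matrix whose second super-diagonal is
`a₁ a₂, a₂ a₃, …, aₙ₋₂ aₙ₋₁`, where `a₁, …, aₙ₋₁` is the first super-diagonal of `H`. -/
def skewK {n : ℕ} (H : Matrix (Fin n) (Fin n) ℝ) : Matrix (Fin n) (Fin n) ℝ :=
  superDiag n 2 (fun i => superEntry H i * superEntry H (i + 1)) -
    (superDiag n 2 (fun i => superEntry H i * superEntry H (i + 1))).transpose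

/-- A Jacobi matrix: real, symmetric, tridiagonal, with pairwise distinct eigenvalues
(the roots of the characteristic polynomial, listed with multiplicity, do not repeat). -/
structure IsJacobi {n : ℕ} (H : Matrix (Fin n) (Fin n) ℝ) : Prop where
  symm : H.IsSymm
  tridiagonal : ∀ i j : Fin n, (i : ℕ) + 1 < (j : ℕ) ∨ (j : ℕ) + 1 < (i : ℕ) → H i j = 0
  distinct : H.charpoly.roots.Nodup

/-- The set of Jacobi matrices with zero diagonal. -/
def jacobiZero (n : ℕ) : Set (Matrix (Fin n) (Fin n) ℝ) :=
  {H | IsJacobi H ∧ ∀ i, H i i = 0}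

/-- The zero-diagonal Jacobi matrices that have the same eigenvalues as `H₀`. -/
def isospectralJacobi {n : ℕ} (H₀ : Matrix (Fin n) (Fin n) ℝ) : Set (Matrix (Fin n) (Fin n) ℝ) :=
  {H | H ∈ jacobiZero n ∧ spectrum ℝ H = spectrum ℝ H₀}

/-- `H` solves `dH/dt = [H, K(H)]` on the set `I` of times
(one-sided derivatives at endpoints of `I`). -/
def SolvesOn {n : ℕ} (H : ℝ → Matrix (Fin n) (Fin n) ℝ) (I : Set ℝ) : Prop :=
  ∀ t ∈ I, HasDerivWithinAt H ⁅H t, skewK (H t)⁆ I t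

/-- The Frobenius norm `√(tr (A Aᵀ))`. -/
noncomputable def frobNorm {n : ℕ} (A : Matrix (Fin n) (Fin n) ℝ) : ℝ :=
  Real.sqrt (A * A.transpose).trace

/-- `spec H = {± l 1, …, ± l m}` with `|l 1| < ⋯ < |l m|`. -/
def EvenSpectrum {n : ℕ} (H : Matrix (Fin n) (Fin n) ℝ) (m : ℕ) (l : ℕ → ℝ) : Prop :=
  spectrum ℝ H = {x | ∃ k ∈ Icc 1 m, x = l k ∨ x = -l k} ∧
    StrictMonoOn (fun k => |l k|) (Icc 1 m)

/-- `spec H = {0, ± l 1, …, ± l m}` with `0 < |l 1| < ⋯ < |l m|`. -/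
def OddSpectrum {n : ℕ} (H : Matrix (Fin n) (Fin n) ℝ) (m : ℕ) (l : ℕ → ℝ) : Prop :=
  spectrum ℝ H = {0} ∪ {x | ∃ k ∈ Icc 1 m, x = l k ∨ x = -l k} ∧
    (∀ k ∈ Icc 1 m, 0 < |l k|) ∧ StrictMonoOn (fun k => |l k|) (Icc 1 m)

/-! ### Autonomous differential equations with a conserved norm -/

section ODE

/-! In the super-diagonal entries the equation is the Volterra lattice `aᵢ' = aᵢ (aᵢ₋₁² - aᵢ₊₁²)`
with `a₀ = aₙ = 0` (`lie_symDiag_skewK`). Its field is orthogonal to the position vector, so the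
Euclidean norm is conserved and a global continuous flow exists (`exists_flow_of_inner_eq_zero`).
Since `K` is skew, the Frobenius norm of `p(H(t))` is constant for every polynomial `p`; taking for
`p` a characteristic polynomial, Cayley–Hamilton shows that the spectrum is constant
(`SolvesOn.spectrum_eq`).

Convergence rests on the partial sums `a₁² + ⋯ + aₖ²`, whose derivative telescopes to `-2 aₖ²
aₖ₊₁²`. They decrease and are nonnegative, so every `aᵢ²` converges; the signs are constant, so
every `aᵢ` converges, to some `αᵢ`. The derivatives converge too, necessarily to `0`, whence `αᵢ
αᵢ₊₁ = 0` and `K` vanishes at the limit. The limit keeps all `n` distinct eigenvalues, so it stays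
in the isospectral set.

For the explicit limit, suppose `aᵢ ≠ 0` and `αᵢ = 0`. Then `αᵢ₋₁² ≤ αᵢ₊₁²`, since otherwise `aᵢ²`
would eventually grow (`limit_sq_le`). Descending from `αₙ = 0` in steps of two, every second entry
vanishes. The limit is a sum of `2 × 2` blocks with eigenvalues `±α`, plus a zero block if `n` is
odd. The same inequality orders the blocks, and simplicity of the spectrum makes the order strict.
-/

theorem exists_lipschitzOnWith_closedBall {E : Type*} [NormedAddCommGroup E] [NormedSpace ℝ E]
    [FiniteDimensional ℝ E] {f : E → E} (hf : ContDiff ℝ 1 f) (R : ℝ) :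
    ∃ K, LipschitzOnWith K f (Metric.closedBall 0 R) := by
  have : ProperSpace E := FiniteDimensional.proper ℝ E
  exact hf.contDiffOn.exists_lipschitzOnWith one_ne_zero (convex_closedBall 0 R)
    (isCompact_closedBall 0 R)

theorem exists_norm_le_of_continuousOn {E : Type*} [NormedAddCommGroup E] {x : ℝ → E} {a b : ℝ}
    (hx : ContinuousOn x (Icc a b)) : ∃ R, ∀ t ∈ Icc a b, ‖x t‖ ≤ R :=
  isCompact_Icc.exists_bound_of_continuousOn hx

/-- Between `0` and `T` both solutions are bounded, hence lie in one ball, where `f` is Lipschitz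
and Grönwall uniqueness applies. -/
theorem eqOn_of_ode {E : Type*} [NormedAddCommGroup E] [NormedSpace ℝ E]
    [FiniteDimensional ℝ E] {f : E → E} (hf : ContDiff ℝ 1 f) {I : Set ℝ} (hI : I.OrdConnected)
    (h0 : (0 : ℝ) ∈ I) {x y : ℝ → E} (hx : ∀ t ∈ I, HasDerivWithinAt x (f (x t)) I t)
    (hy : ∀ t ∈ I, HasDerivWithinAt y (f (y t)) I t) (hxy : x 0 = y 0) : EqOn x y I := by
  have cx : ContinuousOn x I := fun t ht => (hx t ht).continuousWithinAt
  have cy : ContinuousOn y I := fun t ht => (hy t ht).continuousWithinAt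
  intro T hT
  rcases le_total 0 T with h | h
  · have hsub : Icc 0 T ⊆ I := hI.out h0 hT
    obtain ⟨R, hR⟩ := exists_norm_le_of_continuousOn (cx.mono hsub)
    obtain ⟨R', hR'⟩ := exists_norm_le_of_continuousOn (cy.mono hsub)
    obtain ⟨K, hK⟩ := exists_lipschitzOnWith_closedBall hf (max R R')
    refine ODE_solution_unique_of_mem_Icc_right (v := fun _ => f)
      (s := fun _ => Metric.closedBall 0 (max R R')) (fun _ _ => hK) (cx.mono hsub) ?_ ?_
      (cy.mono hsub) ?_ ?_ hxy ⟨h, le_rfl⟩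
    · exact fun t ht => ((hx t (hsub ⟨ht.1, ht.2.le⟩)).mono hsub).mono_of_mem_nhdsWithin
        (Icc_mem_nhdsGE_of_mem ht)
    · exact fun t ht => mem_closedBall_zero_iff.2 ((hR t ⟨ht.1, ht.2.le⟩).trans (le_max_left _ _))
    · exact fun t ht => ((hy t (hsub ⟨ht.1, ht.2.le⟩)).mono hsub).mono_of_mem_nhdsWithin
        (Icc_mem_nhdsGE_of_mem ht)
    · exact fun t ht => mem_closedBall_zero_iff.2 ((hR' t ⟨ht.1, ht.2.le⟩).trans (le_max_right _ _))
  · have hsub : Icc T 0 ⊆ I := hI.out hT h0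
    obtain ⟨R, hR⟩ := exists_norm_le_of_continuousOn (cx.mono hsub)
    obtain ⟨R', hR'⟩ := exists_norm_le_of_continuousOn (cy.mono hsub)
    obtain ⟨K, hK⟩ := exists_lipschitzOnWith_closedBall hf (max R R')
    refine ODE_solution_unique_of_mem_Icc_left (v := fun _ => f)
      (s := fun _ => Metric.closedBall 0 (max R R')) (fun _ _ => hK) (cx.mono hsub) ?_ ?_
      (cy.mono hsub) ?_ ?_ hxy ⟨le_rfl, h⟩
    · exact fun t ht => ((hx t (hsub ⟨ht.1.le, ht.2⟩)).mono hsub).mono_of_mem_nhdsWithin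
        (Icc_mem_nhdsLE_of_mem ht)
    · exact fun t ht => mem_closedBall_zero_iff.2 ((hR t ⟨ht.1.le, ht.2⟩).trans (le_max_left _ _))
    · exact fun t ht => ((hy t (hsub ⟨ht.1.le, ht.2⟩)).mono hsub).mono_of_mem_nhdsWithin
        (Icc_mem_nhdsLE_of_mem ht)
    · exact fun t ht => mem_closedBall_zero_iff.2 ((hR' t ⟨ht.1.le, ht.2⟩).trans (le_max_right _ _))

theorem exists_solution_of_hasCompactSupport {E : Type*} [NormedAddCommGroup E] [NormedSpace ℝ E]
    [FiniteDimensional ℝ E] {g : E → E} (hg : ContDiff ℝ 1 g) (hs : HasCompactSupport g)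
    (x₀ : E) : ∃ x : ℝ → E, x 0 = x₀ ∧ ∀ t, HasDerivAt x (g (x t)) t := by
  obtain ⟨K, hK⟩ := hg.lipschitzWith_of_hasCompactSupport (𝕂 := ℝ) hs one_ne_zero
  obtain ⟨C, hC⟩ := hs.exists_bound_of_continuous hg.continuous
  have hC0 : 0 ≤ C := (norm_nonneg _).trans (hC 0)
  have key : ∀ T : ℝ, 0 ≤ T → ∃ x : ℝ → E, x 0 = x₀ ∧
      ∀ t ∈ Icc (-T) T, HasDerivWithinAt x (g (x t)) (Icc (-T) T) t := by
    intro T hT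
    -- At speed at most `C` a solution moves at most `C * T`, which is the radius of the ball; as
    -- `g` is globally Lipschitz, `T` is unrestricted.
    have : IsPicardLindelof (fun _ => g) (tmin := -T) (tmax := T) ⟨0, by simpa using hT⟩ x₀
        (⟨C, hC0⟩ * ⟨T, hT⟩) 0 ⟨C, hC0⟩ K :=
      IsPicardLindelof.of_time_independent (fun x _ => hC x) hK.lipschitzOnWith (by simp; rfl)
    exact this.exists_eq_forall_mem_Icc_hasDerivWithinAt₀
  choose! α hα0 hα using key
  have agree : ∀ s T : ℝ, |s| ≤ T → α |s| s = α T s := by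
    intro s T hsT
    have hsub : Icc (-|s|) |s| ⊆ Icc (-T) T := Icc_subset_Icc (neg_le_neg hsT) hsT
    have h0s := abs_nonneg s
    refine eqOn_of_ode hg (I := Icc (-|s|) |s|) ordConnected_Icc (by simp)
      (hα _ h0s) (fun t ht => (hα T (h0s.trans hsT) t (hsub ht)).mono hsub) ?_
      ⟨neg_abs_le s, le_abs_self s⟩
    rw [hα0 _ h0s, hα0 _ (h0s.trans hsT)]
  -- The value at `t` is read from the solution on `[-|t|, |t|]`; by `agree`, near `t` it coincides
  -- with one solution on a larger interval.
  refine ⟨fun t => α |t| t, by simp [hα0], fun t => ?_⟩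
  have hT : 0 ≤ |t| + 1 := by positivity
  have ht : t ∈ Ioo (-(|t| + 1)) (|t| + 1) := by
    rw [mem_Ioo, ← abs_lt]; linarith
  have h := (hα _ hT t (Ioo_subset_Icc_self ht)).hasDerivAt (Icc_mem_nhds ht.1 ht.2)
  rw [← agree t (|t| + 1) (by linarith)] at h
  refine h.congr_of_eventuallyEq ?_
  filter_upwards [Ioo_mem_nhds ht.1 ht.2] with s hs
  exact agree s _ (abs_lt.2 hs).le

theorem norm_eq_of_inner_eq_zero {E : Type*} [NormedAddCommGroup E] [InnerProductSpace ℝ E]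
    {g : E → E} (hg : ∀ x, inner ℝ x (g x) = 0) {x : ℝ → E}
    (hx : ∀ t, HasDerivAt x (g (x t)) t) (t : ℝ) : ‖x t‖ = ‖x 0‖ := by
  have h : ∀ s, HasDerivAt (fun s => ‖x s‖ ^ 2) 0 s := fun s => by
    simpa [hg] using (hx s).norm_sq
  have := is_const_of_deriv_eq_zero (fun s => (h s).differentiableAt) (fun s => (h s).deriv) t 0
  exact (sq_eq_sq₀ (norm_nonneg _) (norm_nonneg _)).1 this

/-- Multiplying `f` by a bump function preserves orthogonality, so the truncated solution keeps its
norm and never leaves the ball on which the bump is `1`. -/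
theorem exists_solution_of_inner_eq_zero {E : Type*} [NormedAddCommGroup E]
    [InnerProductSpace ℝ E] [FiniteDimensional ℝ E] {f : E → E} (hf : ContDiff ℝ 1 f)
    (hf0 : ∀ x, inner ℝ x (f x) = 0) (x₀ : E) :
    ∃ x : ℝ → E, x 0 = x₀ ∧ ∀ t, HasDerivAt x (f (x t)) t := by
  let b : ContDiffBump (0 : E) := ⟨‖x₀‖ + 1, ‖x₀‖ + 2, by positivity, by linarith⟩
  obtain ⟨x, hx0, hx⟩ := exists_solution_of_hasCompactSupport (g := fun x => b x • f x)
    (b.contDiff.smul hf) (b.hasCompactSupport.smul_right) x₀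
  refine ⟨x, hx0, fun t => ?_⟩
  have hn := norm_eq_of_inner_eq_zero (g := fun x => b x • f x)
    (fun y => by simp [inner_smul_right, hf0]) hx t
  have hb : b (x t) = 1 := b.one_of_mem_closedBall (by
    rw [mem_closedBall_zero_iff, hn, hx0]; exact (lt_add_one _).le)
  simpa [hb] using hx t

theorem dist_le_of_forward_ode {E : Type*} [NormedAddCommGroup E] [InnerProductSpace ℝ E]
    {f : E → E} (hf0 : ∀ x, inner ℝ x (f x) = 0) {R : ℝ} {K : NNReal}
    (hK : LipschitzOnWith K f (Metric.closedBall 0 R)) {x y : ℝ → E}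
    (hx : ∀ t, HasDerivAt x (f (x t)) t) (hy : ∀ t, HasDerivAt y (f (y t)) t)
    (hxR : ‖x 0‖ ≤ R) (hyR : ‖y 0‖ ≤ R) {t : ℝ} (ht : 0 ≤ t) :
    dist (x t) (y t) ≤ dist (x 0) (y 0) * Real.exp (K * t) := by
  simpa using dist_le_of_trajectories_ODE_of_mem (v := fun _ => f)
    (s := fun _ => Metric.closedBall 0 R) (fun _ _ => hK)
    (fun s _ => (hx s).continuousAt.continuousWithinAt) (fun s _ => (hx s).hasDerivWithinAt)
    (fun s _ => mem_closedBall_zero_iff.2 ((norm_eq_of_inner_eq_zero hf0 hx s).trans_le hxR))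
    (fun s _ => (hy s).continuousAt.continuousWithinAt) (fun s _ => (hy s).hasDerivWithinAt)
    (fun s _ => mem_closedBall_zero_iff.2 ((norm_eq_of_inner_eq_zero hf0 hy s).trans_le hyR))
    le_rfl t (right_mem_Icc.2 ht)

theorem dist_le_of_ode {E : Type*} [NormedAddCommGroup E] [InnerProductSpace ℝ E]
    {f : E → E} (hf0 : ∀ x, inner ℝ x (f x) = 0) {R : ℝ} {K : NNReal}
    (hK : LipschitzOnWith K f (Metric.closedBall 0 R)) {x y : ℝ → E}
    (hx : ∀ t, HasDerivAt x (f (x t)) t) (hy : ∀ t, HasDerivAt y (f (y t)) t)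
    (hxR : ‖x 0‖ ≤ R) (hyR : ‖y 0‖ ≤ R) (t : ℝ) :
    dist (x t) (y t) ≤ dist (x 0) (y 0) * Real.exp (K * |t|) := by
  rcases le_total 0 t with ht | ht
  · rw [abs_of_nonneg ht]
    exact dist_le_of_forward_ode hf0 hK hx hy hxR hyR ht
  · rw [abs_of_nonpos ht]
    -- Negative times follow by time reversal: `-f` is still orthogonal to the position and has the
    -- same Lipschitz constant.
    have rev : ∀ {z : ℝ → E}, (∀ t, HasDerivAt z (f (z t)) t) →
        ∀ t, HasDerivAt (fun s => z (-s)) (-f (z (-t))) t := fun hz t => by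
      simpa [Function.comp_def] using (hz (-t)).scomp t (hasDerivAt_neg t)
    have := dist_le_of_forward_ode (f := fun z => -f z) (x := fun s => x (-s))
      (y := fun s => y (-s)) (fun z => by simp [hf0]) hK.neg (rev hx) (rev hy)
      (by simpa using hxR) (by simpa using hyR) (neg_nonneg.2 ht)
    simpa using this

theorem exists_flow_of_inner_eq_zero {E : Type*} [NormedAddCommGroup E]
    [InnerProductSpace ℝ E] [FiniteDimensional ℝ E] {f : E → E} (hf : ContDiff ℝ 1 f)
    (hf0 : ∀ x, inner ℝ x (f x) = 0) :
    ∃ φ : Flow ℝ E, ∀ x t, HasDerivAt (fun s => φ s x) (f (φ t x)) t := by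
  choose ψ hψ0 hψ using exists_solution_of_inner_eq_zero hf hf0
  refine ⟨⟨fun t x => ψ x t, ?_, fun s t x => ?_, hψ0⟩, hψ⟩
  · rw [continuous_iff_continuousAt]
    rintro ⟨t₀, x₀⟩
    obtain ⟨K, hK⟩ := exists_lipschitzOnWith_closedBall hf (‖x₀‖ + 1)
    -- Joint continuity: continuous in `t`, and Lipschitz in `x` with a constant uniform for `|t| ≤
    -- |t₀| + 1`.
    have hcont : ContinuousOn (Function.uncurry fun t x => ψ x t)
        (Icc (-(|t₀| + 1)) (|t₀| + 1) ×ˢ Metric.closedBall 0 (‖x₀‖ + 1)) := by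
      refine continuousOn_prod_of_continuousOn_lipschitzOnWith' _
        (K := (Real.exp (K * (|t₀| + 1))).toNNReal) ?_ ?_
      · intro t ht
        refine LipschitzOnWith.of_dist_le_mul fun x hx y hy => ?_
        rw [Real.coe_toNNReal _ (Real.exp_pos _).le, mul_comm]
        rw [mem_closedBall_zero_iff] at hx hy
        have := dist_le_of_ode hf0 hK (hψ x) (hψ y) (by rwa [hψ0]) (by rwa [hψ0]) t
        rw [hψ0, hψ0] at this
        refine this.trans ?_
        gcongr
        exact abs_le.2 ht
      · exact fun x _ t _ => (hψ x t).continuousAt.continuousWithinAt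
    refine hcont.continuousAt (prod_mem_nhds ?_ ?_)
    · have := abs_lt.1 (lt_add_one |t₀|)
      exact Icc_mem_nhds this.1 this.2
    · exact mem_of_superset (Metric.ball_mem_nhds x₀ one_pos) fun y hy => by
        rw [mem_closedBall_zero_iff]
        have := norm_le_norm_add_norm_sub' y x₀
        rw [← dist_eq_norm] at this
        exact this.trans (by gcongr; exact (Metric.mem_ball.1 hy).le)
  · refine eqOn_of_ode hf (I := univ) ordConnected_univ (mem_univ _)
      (x := fun s => ψ x (s + t)) (y := ψ (ψ x t)) (fun r _ => ?_)
      (fun r _ => (hψ _ r).hasDerivWithinAt) (by simp [hψ0]) (mem_univ s)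
    exact ((hψ x (r + t)).comp_add_const r t).hasDerivWithinAt

end ODE

/-! ### Zero-diagonal symmetric tridiagonal matrices -/

section Tridiagonal

theorem symDiag_apply {n p : ℕ} (a : ℕ → ℝ) (i j : Fin n) :
    symDiag n p a i j = (if (j : ℕ) = i + p then a (i + 1) else 0) +
      (if (i : ℕ) = j + p then a (j + 1) else 0) := rfl

theorem skewK_apply {n : ℕ} (H : Matrix (Fin n) (Fin n) ℝ) (i j : Fin n) :
    skewK H i j =
      (if (j : ℕ) = i + 2 then superEntry H (i + 1) * superEntry H (i + 1 + 1) else 0) -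
      (if (i : ℕ) = j + 2 then superEntry H (j + 1) * superEntry H (j + 1 + 1) else 0) := rfl

theorem symDiag_isSymm (n p : ℕ) (a : ℕ → ℝ) : (symDiag n p a).IsSymm := by
  rw [Matrix.IsSymm, symDiag, Matrix.transpose_add, Matrix.transpose_transpose, add_comm]

theorem symDiag_congr {n : ℕ} {a b : ℕ → ℝ} (h : ∀ i, 1 ≤ i → i < n → a i = b i) :
    symDiag n 1 a = symDiag n 1 b := by
  ext i j
  have := i.2
  have := j.2
  simp only [symDiag_apply]
  congr 1 <;> split_ifs <;> first | rfl | exact h _ (by omega) (by omega)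

theorem superEntry_symDiag {n : ℕ} (a : ℕ → ℝ) (i : ℕ) :
    superEntry (symDiag n 1 a) i = if 1 ≤ i ∧ i < n then a i else 0 := by
  rw [superEntry]
  split_ifs with h
  · rw [symDiag_apply, if_pos (by dsimp only; omega), if_neg (by dsimp only; omega)]
    simp [Nat.sub_add_cancel h.1]
  · rfl

theorem superEntry_zero {n : ℕ} (H : Matrix (Fin n) (Fin n) ℝ) : superEntry H 0 = 0 := by
  simp [superEntry]

theorem superEntry_of_le {n : ℕ} (H : Matrix (Fin n) (Fin n) ℝ) {i : ℕ} (hi : n ≤ i) :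
    superEntry H i = 0 := by
  rw [superEntry, dif_neg (by omega)]

theorem superEntry_symDiag_of_boundary {n : ℕ} {a : ℕ → ℝ} (h0 : a 0 = 0)
    (hn : ∀ i, n ≤ i → a i = 0) (i : ℕ) : superEntry (symDiag n 1 a) i = a i := by
  rw [superEntry_symDiag]
  split_ifs with h
  · rfl
  · rcases Nat.eq_zero_or_pos i with rfl | hi
    · exact h0.symm
    · exact (hn i (by omega)).symm

theorem symDiag_superEntry {n : ℕ} {H : Matrix (Fin n) (Fin n) ℝ} (hH : H ∈ jacobiZero n) :
    symDiag n 1 (superEntry H) = H := by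
  obtain ⟨hJ, hd⟩ := hH
  ext i j
  rw [symDiag_apply]
  have hi := i.2
  have hj := j.2
  rcases lt_trichotomy (i : ℕ) j with h | h | h
  · rw [if_neg (show ¬ (i : ℕ) = j + 1 by omega), add_zero]
    split_ifs with h1
    · rw [superEntry, dif_pos (by omega)]
      congr 1
      exact Fin.ext h1.symm
    · exact (hJ.tridiagonal i j (Or.inl (by omega))).symm
  · rw [if_neg (by omega), if_neg (by omega), Fin.ext h, hd, add_zero]
  · rw [if_neg (show ¬ (j : ℕ) = i + 1 by omega), zero_add]
    split_ifs with h1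
    · rw [superEntry, dif_pos (by omega), ← hJ.symm.apply]
      congr 1
      exact Fin.ext h1.symm
    · exact (hJ.tridiagonal i j (Or.inr (by omega))).symm

/-- The boundary zeros make the first and last rows unexceptional: the truncated `i - 1` at `i = 0`
and the value `v n` are multiplied by `0`. -/
theorem sum_symDiag_mul {n : ℕ} {a : ℕ → ℝ} (h0 : a 0 = 0) (hn : ∀ i, n ≤ i → a i = 0)
    (v : ℕ → ℝ) (i : Fin n) :
    ∑ k : Fin n, symDiag n 1 a i k * v k = a i * v (i - 1) + a (i + 1) * v (i + 1) := by
  simp only [symDiag_apply, add_mul, Finset.sum_add_distrib, ite_mul, zero_mul]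
  rw [Fin.sum_univ_eq_sum_range (fun k => if k = (i : ℕ) + 1 then a (i + 1) * v k else 0),
    Fin.sum_univ_eq_sum_range (fun k => if (i : ℕ) = k + 1 then a (k + 1) * v k else 0),
    Finset.sum_ite_eq', add_comm]
  congr 1
  · rcases h : (i : ℕ) with _ | m
    · simp [h0]
    · have : m ∈ Finset.range n := Finset.mem_range.2 (by omega)
      simp [this]
  · split_ifs with h
    · rfl
    · rw [hn _ (by simpa using h), zero_mul]

theorem sum_mul_symDiag {n : ℕ} {a : ℕ → ℝ} (h0 : a 0 = 0) (hn : ∀ i, n ≤ i → a i = 0)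
    (v : ℕ → ℝ) (j : Fin n) :
    ∑ k : Fin n, v k * symDiag n 1 a k j = a j * v (j - 1) + a (j + 1) * v (j + 1) := by
  rw [← sum_symDiag_mul h0 hn]
  refine Finset.sum_congr rfl fun k _ => ?_
  rw [mul_comm, (symDiag_isSymm n 1 a).apply]

/-- The right-hand side of the Volterra lattice `aᵢ' = aᵢ (aᵢ₋₁² - aᵢ₊₁²)`. -/
def volterraField (a : ℕ → ℝ) (i : ℕ) : ℝ := a i * (a (i - 1) ^ 2 - a (i + 1) ^ 2)

/-- The products live on the diagonals at distance one and three; at distance three the two triple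
products cancel, at distance one the Volterra field remains. -/
theorem lie_symDiag_skewK {n : ℕ} {a : ℕ → ℝ} (h0 : a 0 = 0) (hn : ∀ i, n ≤ i → a i = 0) :
    ⁅symDiag n 1 a, skewK (symDiag n 1 a)⁆ = symDiag n 1 (volterraField a) := by
  ext i j
  let k : ℕ → ℕ → ℝ := fun i j => (if j = i + 2 then a (i + 1) * a (i + 1 + 1) else 0) -
      (if i = j + 2 then a (j + 1) * a (j + 1 + 1) else 0)
  have hk : ∀ i j : Fin n, skewK (symDiag n 1 a) i j = k i j := fun i j => by
    simp only [skewK_apply, superEntry_symDiag_of_boundary h0 hn, k]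
  simp only [Ring.lie_def, Matrix.sub_apply, Matrix.mul_apply, hk]
  rw [sum_symDiag_mul h0 hn (fun m => k m j), sum_mul_symDiag h0 hn (fun m => k i m)]
  simp only [symDiag_apply, k, volterraField]
  generalize (i : ℕ) = i
  generalize (j : ℕ) = j
  rcases i with _ | i <;> rcases j with _ | j <;> simp [h0] <;> split_ifs <;>
    first | omega | (subst_vars; ring)

theorem skewK_transpose {n : ℕ} (H : Matrix (Fin n) (Fin n) ℝ) :
    (skewK H).transpose = -skewK H := by
  simp [skewK]

theorem diag_symDiag {n : ℕ} (a : ℕ → ℝ) (i : Fin n) : symDiag n 1 a i i = 0 := by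
  simp [symDiag_apply]

theorem coe_roots_charpoly_toFinset {n : ℕ} (A : Matrix (Fin n) (Fin n) ℝ) :
    (A.charpoly.roots.toFinset : Set ℝ) = spectrum ℝ A := by
  ext x
  rw [Matrix.mem_spectrum_iff_isRoot_charpoly]
  simp [A.charpoly_monic.ne_zero]

theorem spectrum_finite {n : ℕ} (A : Matrix (Fin n) (Fin n) ℝ) : (spectrum ℝ A).Finite := by
  rw [← coe_roots_charpoly_toFinset]
  exact Finset.finite_toSet _

theorem card_roots_charpoly_le {n : ℕ} (A : Matrix (Fin n) (Fin n) ℝ) :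
    A.charpoly.roots.card ≤ n := by
  simpa using A.charpoly.card_roots'

theorem ncard_spectrum_le {n : ℕ} (A : Matrix (Fin n) (Fin n) ℝ) :
    (spectrum ℝ A).ncard ≤ n := by
  rw [← coe_roots_charpoly_toFinset, Set.ncard_coe_finset]
  exact (Multiset.toFinset_card_le _).trans (card_roots_charpoly_le A)

/-- A real symmetric matrix has `n` real eigenvalues with multiplicity, so simplicity is a condition
on the spectrum as a set and passes along isospectral matrices. -/
theorem nodup_roots_charpoly_iff {n : ℕ} {A : Matrix (Fin n) (Fin n) ℝ} (hA : A.IsSymm) :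
    A.charpoly.roots.Nodup ↔ (spectrum ℝ A).ncard = n := by
  rw [← coe_roots_charpoly_toFinset, Set.ncard_coe_finset]
  have hcard : A.charpoly.roots.card = n := by
    have hH : A.IsHermitian := by
      rw [Matrix.IsHermitian, Matrix.conjTranspose_eq_transpose_of_trivial, hA]
    simp [hH.roots_charpoly_eq_eigenvalues]
  rw [← Multiset.toFinset_card_eq_card_iff_nodup, hcard]

theorem symDiag_mem_jacobiZero_iff {n : ℕ} {a : ℕ → ℝ} :
    symDiag n 1 a ∈ jacobiZero n ↔ (spectrum ℝ (symDiag n 1 a)).ncard = n := by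
  have hs := symDiag_isSymm n 1 a
  refine ⟨fun h => (nodup_roots_charpoly_iff hs).1 h.1.distinct, fun h =>
    ⟨⟨hs, fun i j hij => ?_, (nodup_roots_charpoly_iff hs).2 h⟩, diag_symDiag a⟩⟩
  rw [symDiag_apply, if_neg (by omega), if_neg (by omega), add_zero]

theorem ncard_spectrum_of_mem_jacobiZero {n : ℕ} {H : Matrix (Fin n) (Fin n) ℝ}
    (hH : H ∈ jacobiZero n) : (spectrum ℝ H).ncard = n :=
  (nodup_roots_charpoly_iff hH.1.symm).1 hH.1.distinct

end Tridiagonal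

/-! ### The matrix equation -/

section MatrixODE

theorem hasDerivWithinAt_matrix {n : ℕ} {H : ℝ → Matrix (Fin n) (Fin n) ℝ}
    {H' : Matrix (Fin n) (Fin n) ℝ} {s : Set ℝ} {t : ℝ} :
    HasDerivWithinAt H H' s t ↔ ∀ i j, HasDerivWithinAt (fun t => H t i j) (H' i j) s t :=
  (hasDerivWithinAt_pi (φ := H) (φ' := H')).trans
    (forall_congr' fun i => hasDerivWithinAt_pi (φ := fun t => H t i) (φ' := H' i))

theorem SolvesOn.mono {n : ℕ} {H : ℝ → Matrix (Fin n) (Fin n) ℝ} {I J : Set ℝ}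
    (hH : SolvesOn H J) (hIJ : I ⊆ J) : SolvesOn H I := fun t ht =>
  hasDerivWithinAt_matrix.2 fun i j => (hasDerivWithinAt_matrix.1 (hH t (hIJ ht)) i j).mono hIJ

theorem contDiff_superEntry {n : ℕ} (i : ℕ) :
    ContDiff ℝ 1 (fun H : Fin n → Fin n → ℝ => superEntry (Matrix.of H) i) := by
  unfold superEntry
  split_ifs with h
  · exact contDiff_apply_apply ℝ ℝ _ _
  · exact contDiff_const

theorem contDiff_skewK {n : ℕ} (i j : Fin n) :
    ContDiff ℝ 1 (fun H : Fin n → Fin n → ℝ => skewK (Matrix.of H) i j) := by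
  simp only [skewK_apply]
  refine ContDiff.sub ?_ ?_ <;> split_ifs <;>
    first | exact contDiff_const | exact (contDiff_superEntry _).mul (contDiff_superEntry _)

theorem contDiff_lie_skewK (n : ℕ) :
    ContDiff ℝ 1 (fun H : Fin n → Fin n → ℝ =>
      (fun i j => (⁅Matrix.of H, skewK (Matrix.of H)⁆ : Matrix (Fin n) (Fin n) ℝ) i j)) := by
  refine contDiff_pi.2 fun i => contDiff_pi.2 fun j => ?_
  change ContDiff ℝ 1 fun H : Fin n → Fin n → ℝ =>
    (Matrix.of H * skewK (Matrix.of H) - skewK (Matrix.of H) * Matrix.of H) i j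
  simp only [Matrix.sub_apply, Matrix.mul_apply]
  exact (ContDiff.sum fun k _ => (contDiff_apply_apply ℝ ℝ i k).mul (contDiff_skewK k j)).sub
    (ContDiff.sum fun k _ => (contDiff_skewK i k).mul (contDiff_apply_apply ℝ ℝ k j))

theorem SolvesOn.eqOn {n : ℕ} {G H : ℝ → Matrix (Fin n) (Fin n) ℝ} {I : Set ℝ}
    (hI : I.OrdConnected) (h0 : (0 : ℝ) ∈ I) (hG : SolvesOn G I) (hH : SolvesOn H I)
    (hGH : G 0 = H 0) : EqOn G H I :=
  eqOn_of_ode (E := Fin n → Fin n → ℝ) (contDiff_lie_skewK n) hI h0 hG hH hGH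

theorem hasDerivAt_matrix {n : ℕ} {H : ℝ → Matrix (Fin n) (Fin n) ℝ}
    {H' : Matrix (Fin n) (Fin n) ℝ} {t : ℝ} :
    HasDerivAt H H' t ↔ ∀ i j, HasDerivAt (fun t => H t i j) (H' i j) t :=
  (hasDerivAt_pi (φ := H) (φ' := H')).trans
    (forall_congr' fun i => hasDerivAt_pi (φ := fun t => H t i) (φ' := H' i))

theorem HasDerivAt.matrix_mul' {n : ℕ} {A B : ℝ → Matrix (Fin n) (Fin n) ℝ}
    {A' B' : Matrix (Fin n) (Fin n) ℝ} {t : ℝ} (hA : HasDerivAt A A' t) (hB : HasDerivAt B B' t) :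
    HasDerivAt (fun s => A s * B s) (A' * B t + A t * B') t := by
  rw [hasDerivAt_matrix] at *
  intro i j
  simp only [Matrix.add_apply, Matrix.mul_apply, ← Finset.sum_add_distrib]
  exact HasDerivAt.fun_sum fun k _ => (hA i k).mul (hB k j)

/-- Bracketing with `K` is a derivation, so powers of `H`, and then polynomials in `H`, obey the
same linear equation. -/
theorem hasDerivAt_aeval_of_lie {n : ℕ} {H K : ℝ → Matrix (Fin n) (Fin n) ℝ}
    (hH : ∀ t, HasDerivAt H ⁅H t, K t⁆ t) (p : Polynomial ℝ) (t : ℝ) :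
    HasDerivAt (fun s => Polynomial.aeval (H s) p) ⁅Polynomial.aeval (H t) p, K t⁆ t := by
  have hpow : ∀ k : ℕ, HasDerivAt (fun s => H s ^ k) ⁅H t ^ k, K t⁆ t := by
    intro k
    induction k with
    | zero =>
      refine hasDerivAt_matrix.2 fun i j => ?_
      simpa [Ring.lie_def] using hasDerivAt_const t ((1 : Matrix (Fin n) (Fin n) ℝ) i j)
    | succ k ih =>
      simp only [pow_succ]
      convert ih.matrix_mul' (hH t) using 1
      simp only [Ring.lie_def]
      noncomm_ring
  refine hasDerivAt_matrix.2 ?_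
  induction p using Polynomial.induction_on' with
  | add p q hp hq =>
    intro i j
    have h := (hp i j).fun_add (hq i j)
    simp only [← Matrix.add_apply, ← map_add] at h
    refine h.congr_deriv ?_
    simp only [map_add, Ring.lie_def, add_mul, mul_add, Matrix.sub_apply, Matrix.add_apply]
    ring
  | monomial k c =>
    intro i j
    have h := (hasDerivAt_matrix.1 (hpow k) i j).const_mul c
    simp only [Polynomial.aeval_monomial, ← Algebra.smul_def]
    refine h.congr_deriv ?_
    simp only [Ring.lie_def, smul_mul_assoc, mul_smul_comm, ← smul_sub, Matrix.smul_apply,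
      smul_eq_mul]

/-- Transposition turns each of the two traces into its negative. -/
theorem trace_lie_mul_transpose {n : ℕ} (X : Matrix (Fin n) (Fin n) ℝ)
    {K : Matrix (Fin n) (Fin n) ℝ} (hK : K.transpose = -K) :
    (⁅X, K⁆ * X.transpose).trace = 0 := by
  have h1 : (X * K * X.transpose).trace = 0 := by
    have := Matrix.trace_transpose (X * K * X.transpose)
    simp only [Matrix.transpose_mul, Matrix.transpose_transpose, hK, Matrix.neg_mul,
      Matrix.mul_neg, Matrix.trace_neg, Matrix.mul_assoc] at this ⊢
    linarith
  have h2 : (K * X * X.transpose).trace = 0 := by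
    have := Matrix.trace_transpose (K * X * X.transpose)
    simp only [Matrix.transpose_mul, Matrix.transpose_transpose, hK,
      Matrix.mul_neg, Matrix.trace_neg] at this
    rw [← Matrix.mul_assoc, Matrix.trace_mul_comm, ← Matrix.mul_assoc] at this
    linarith
  rw [Ring.lie_def, sub_mul, Matrix.trace_sub, h1, h2, sub_zero]

/-- The squared Frobenius norm has derivative zero, so a solution that vanishes once vanishes
always. -/
theorem eq_zero_of_lie_skew {n : ℕ} {X K : ℝ → Matrix (Fin n) (Fin n) ℝ}
    (hX : ∀ t, HasDerivAt X ⁅X t, K t⁆ t) (hK : ∀ t, (K t).transpose = -K t) {s : ℝ}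
    (hs : X s = 0) (t : ℝ) : X t = 0 := by
  have hd : ∀ t, HasDerivAt (fun t => (X t * (X t).transpose).trace) 0 t := by
    intro t
    have hT : HasDerivAt (fun t => (X t).transpose) ⁅X t, K t⁆.transpose t :=
      hasDerivAt_matrix.2 fun i j => hasDerivAt_matrix.1 (hX t) j i
    have hm := hasDerivAt_matrix.1 ((hX t).matrix_mul' hT)
    have htr : HasDerivAt (fun t => (X t * (X t).transpose).trace)
        (⁅X t, K t⁆ * (X t).transpose + X t * ⁅X t, K t⁆.transpose).trace t :=
      HasDerivAt.fun_sum fun i _ => hm i i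
    have h0 := trace_lie_mul_transpose (X t) (hK t)
    rw [Matrix.trace_add, h0, ← Matrix.trace_transpose (X t * _), Matrix.transpose_mul,
      Matrix.transpose_transpose, h0, add_zero] at htr
    exact htr
  have hc := is_const_of_deriv_eq_zero (fun t => (hd t).differentiableAt)
    (fun t => (hd t).deriv) t s
  simp only [hs, zero_mul, Matrix.trace_zero] at hc
  rwa [← Matrix.conjTranspose_eq_transpose_of_trivial,
    Matrix.trace_mul_conjTranspose_self_eq_zero_iff] at hc

theorem spectrum_subset_of_aeval_charpoly {n : ℕ} {A B : Matrix (Fin n) (Fin n) ℝ}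
    (h : Polynomial.aeval A B.charpoly = 0) : spectrum ℝ A ⊆ spectrum ℝ B := by
  intro x hx
  rw [Matrix.mem_spectrum_iff_isRoot_charpoly]
  have := spectrum.subset_polynomial_aeval A B.charpoly ⟨x, hx, rfl⟩
  rw [h] at this
  -- For `n = 0` the matrix ring is trivial and even `0` has empty spectrum.
  rcases subsingleton_or_nontrivial (Matrix (Fin n) (Fin n) ℝ) with hn | hn
  · simp [spectrum.of_subsingleton] at this
  · simpa [spectrum.zero_eq] using this

theorem SolvesOn.hasDerivAt {n : ℕ} {H : ℝ → Matrix (Fin n) (Fin n) ℝ} (hH : SolvesOn H univ)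
    (t : ℝ) : HasDerivAt H ⁅H t, skewK (H t)⁆ t :=
  hasDerivAt_matrix.2 fun i j =>
    hasDerivWithinAt_univ.1 (hasDerivWithinAt_matrix.1 (hH t (mem_univ t)) i j)

theorem SolvesOn.spectrum_eq {n : ℕ} {H : ℝ → Matrix (Fin n) (Fin n) ℝ} (hH : SolvesOn H univ)
    (s t : ℝ) : spectrum ℝ (H s) = spectrum ℝ (H t) := by
  have key : ∀ s t, spectrum ℝ (H s) ⊆ spectrum ℝ (H t) := fun s t =>
    spectrum_subset_of_aeval_charpoly <| eq_zero_of_lie_skew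
      (hasDerivAt_aeval_of_lie (K := fun t => skewK (H t)) hH.hasDerivAt (H t).charpoly)
      (fun t => skewK_transpose (H t)) (Matrix.aeval_self_charpoly (H t)) s
  exact (key s t).antisymm (key t s)

end MatrixODE

/-! ### Asymptotics of the Volterra lattice -/

section Volterra

/-- A solution, defined for all times, of the finite Volterra lattice with `a₀ = 0` and
`aᵢ = 0` for `i ≥ n`. -/
structure IsVolterraPath (n : ℕ) (a : ℝ → ℕ → ℝ) : Prop where
  zero_left : ∀ t, a t 0 = 0
  zero_right : ∀ t i, n ≤ i → a t i = 0
  deriv : ∀ t i, HasDerivAt (fun s => a s i) (volterraField (a t) i) t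

theorem sum_mul_volterraField {a : ℕ → ℝ} (h0 : a 0 = 0) (k : ℕ) :
    ∑ i ∈ Finset.range (k + 1), 2 * a i * volterraField a i = -2 * a k ^ 2 * a (k + 1) ^ 2 := by
  induction k with
  | zero => simp [h0]
  | succ k ih =>
    rw [Finset.sum_range_succ, ih]
    simp only [volterraField, Nat.add_sub_cancel]
    ring

/-- By the mean value theorem on `[t, t + 1]`, the derivative takes values `f (t + 1) - f t → 0` at
arbitrarily late times. -/
theorem eq_zero_of_tendsto_deriv {f f' : ℝ → ℝ} {L c : ℝ} (hf : ∀ t, HasDerivAt f (f' t) t)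
    (hL : Tendsto f atTop (𝓝 L)) (hc : Tendsto f' atTop (𝓝 c)) : c = 0 := by
  have hmvt : ∀ t : ℝ, ∃ ξ, t ≤ ξ ∧ f' ξ = f (t + 1) - f t := fun t => by
    obtain ⟨ξ, hξ, h⟩ := exists_hasDerivAt_eq_slope f f' (lt_add_one t)
      (fun s _ => (hf s).continuousAt.continuousWithinAt) (fun s _ => hf s)
    exact ⟨ξ, hξ.1.le, by simpa using h⟩
  choose ξ hξ hξ' using hmvt
  have h1 : Tendsto (fun t => f' (ξ t)) atTop (𝓝 c) :=
    hc.comp (tendsto_atTop_mono hξ tendsto_id)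
  have h2 : Tendsto (fun t => f (t + 1) - f t) atTop (𝓝 (L - L)) :=
    (hL.comp (tendsto_atTop_add_const_right _ _ tendsto_id)).sub hL
  simp only [hξ', sub_self] at h1 h2
  exact tendsto_nhds_unique h1 h2

theorem eq_mul_exp_integral {x c : ℝ → ℝ} (hc : Continuous c)
    (hx : ∀ t, HasDerivAt x (x t * c t) t) (t : ℝ) :
    x t = x 0 * Real.exp (∫ s in (0 : ℝ)..t, c s) := by
  have hC : ∀ t, HasDerivAt (fun t => ∫ s in (0 : ℝ)..t, c s) (c t) t := fun t =>
    intervalIntegral.integral_hasDerivAt_right (hc.intervalIntegrable _ _)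
      hc.stronglyMeasurable.stronglyMeasurableAtFilter hc.continuousAt
  have hd : ∀ t, HasDerivAt (fun t => x t * Real.exp (-∫ s in (0 : ℝ)..t, c s)) 0 t := fun t =>
    ((hx t).mul (hC t).neg.exp).congr_deriv (by ring)
  have h := is_const_of_deriv_eq_zero (fun t => (hd t).differentiableAt)
    (fun t => (hd t).deriv) t 0
  simp only [intervalIntegral.integral_same, neg_zero, Real.exp_zero, mul_one] at h
  rw [← h, mul_assoc, ← Real.exp_add, neg_add_cancel, Real.exp_zero, mul_one]

namespace IsVolterraPath

variable {n : ℕ} {a : ℝ → ℕ → ℝ}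

theorem continuous (h : IsVolterraPath n a) (i : ℕ) : Continuous fun t => a t i :=
  continuous_iff_continuousAt.2 fun t => (h.deriv t i).continuousAt

theorem hasDerivAt_sum (h : IsVolterraPath n a) (k : ℕ) (t : ℝ) :
    HasDerivAt (fun s => ∑ i ∈ Finset.range (k + 1), a s i ^ 2)
      (-2 * a t k ^ 2 * a t (k + 1) ^ 2) t := by
  rw [← sum_mul_volterraField (h.zero_left t)]
  exact HasDerivAt.fun_sum fun i _ => ((h.deriv t i).fun_pow 2).congr_deriv (by simp)

theorem exists_tendsto_sum (h : IsVolterraPath n a) (k : ℕ) :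
    ∃ S, Tendsto (fun t => ∑ i ∈ Finset.range k, a t i ^ 2) atTop (𝓝 S) := by
  rcases k with _ | k
  · exact ⟨0, by simp⟩
  · refine ⟨_, tendsto_atTop_ciInf (antitone_of_hasDerivAt_nonpos (h.hasDerivAt_sum k) fun t => ?_)
      ⟨0, ?_⟩⟩
    · have : 0 ≤ a t k ^ 2 * a t (k + 1) ^ 2 := by positivity
      simp only [Pi.zero_apply]
      linarith
    · rintro _ ⟨t, rfl⟩
      exact Finset.sum_nonneg fun i _ => sq_nonneg _

theorem exists_tendsto_sq (h : IsVolterraPath n a) (i : ℕ) :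
    ∃ β, Tendsto (fun t => a t i ^ 2) atTop (𝓝 β) := by
  obtain ⟨S, hS⟩ := h.exists_tendsto_sum i
  obtain ⟨S', hS'⟩ := h.exists_tendsto_sum (i + 1)
  exact ⟨S' - S, (hS'.sub hS).congr fun t => by rw [Finset.sum_range_succ]; ring⟩

/-- Each component solves a scalar linear equation, so it keeps its sign, and stays zero if it
starts at zero. -/
theorem exists_eq_mul_exp (h : IsVolterraPath n a) (t : ℝ) (i : ℕ) :
    ∃ r, a t i = a 0 i * Real.exp r :=
  ⟨_, eq_mul_exp_integral (((h.continuous (i - 1)).pow 2).sub ((h.continuous (i + 1)).pow 2))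
    (fun t => h.deriv t i) t⟩

theorem eq_sign_mul_abs (h : IsVolterraPath n a) (t : ℝ) (i : ℕ) :
    a t i = Real.sign (a 0 i) * |a t i| := by
  obtain ⟨r, hr⟩ := h.exists_eq_mul_exp t i
  rw [hr, abs_mul, abs_of_pos (Real.exp_pos r), ← mul_assoc]
  congr 1
  rcases lt_trichotomy (a 0 i) 0 with h0 | h0 | h0
  · rw [Real.sign_of_neg h0, abs_of_neg h0]; ring
  · simp [h0]
  · rw [Real.sign_of_pos h0, abs_of_pos h0]; ring

theorem ne_zero (h : IsVolterraPath n a) {i : ℕ} (hi : a 0 i ≠ 0) (t : ℝ) : a t i ≠ 0 := by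
  obtain ⟨r, hr⟩ := h.exists_eq_mul_exp t i
  rw [hr]
  exact mul_ne_zero hi (Real.exp_pos r).ne'

theorem exists_tendsto (h : IsVolterraPath n a) (i : ℕ) :
    ∃ α, Tendsto (fun t => a t i) atTop (𝓝 α) := by
  obtain ⟨β, hβ⟩ := h.exists_tendsto_sq i
  refine ⟨Real.sign (a 0 i) * √β, ((hβ.sqrt).const_mul _).congr fun t => ?_⟩
  rw [Real.sqrt_sq_eq_abs, ← h.eq_sign_mul_abs]

theorem limit_mul_eq_zero (h : IsVolterraPath n a) {α : ℕ → ℝ}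
    (hα : ∀ i, Tendsto (fun t => a t i) atTop (𝓝 (α i))) (i : ℕ) : α i * α (i + 1) = 0 := by
  obtain ⟨S, hS⟩ := h.exists_tendsto_sum (i + 1)
  have := eq_zero_of_tendsto_deriv (h.hasDerivAt_sum i) hS
    ((((hα i).pow 2).const_mul (-2)).mul ((hα (i + 1)).pow 2))
  have h2 : (α i * α (i + 1)) ^ 2 = 0 := by linarith
  exact pow_eq_zero_iff two_ne_zero |>.1 h2

/-- If the inequality failed, the growth rate of `aᵢ²` would eventually be positive, and a nonzero
quantity that does not decrease cannot tend to `0`. -/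
theorem limit_sq_le (h : IsVolterraPath n a) {α : ℕ → ℝ}
    (hα : ∀ i, Tendsto (fun t => a t i) atTop (𝓝 (α i))) {i : ℕ} (hi : a 0 i ≠ 0)
    (hαi : α i = 0) : α (i - 1) ^ 2 ≤ α (i + 1) ^ 2 := by
  by_contra! hlt
  obtain ⟨T, hT⟩ := eventually_atTop.1
    (((hα (i + 1)).pow 2).eventually_lt ((hα (i - 1)).pow 2) hlt)
  have hmono : MonotoneOn (fun t => a t i ^ 2) (Ici T) := by
    refine monotoneOn_of_hasDerivWithinAt_nonneg (convex_Ici T)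
      (fun t _ => ((h.continuous i).pow 2).continuousWithinAt)
      (fun t _ => ((h.deriv t i).fun_pow 2).hasDerivWithinAt) fun t ht => ?_
    have h1 := hT t (interior_subset ht)
    have h2 := mul_nonneg (sq_nonneg (a t i)) (sub_pos.2 h1).le
    simp only [volterraField, Nat.cast_ofNat, Nat.add_one_sub_one, pow_one]
    linarith
  have hle : a T i ^ 2 ≤ α i ^ 2 := ge_of_tendsto ((hα i).pow 2) <| by
    filter_upwards [eventually_ge_atTop T] with t ht
    exact hmono (mem_Ici.2 le_rfl) ht ht
  have := pow_pos (abs_pos.2 (h.ne_zero hi T)) 2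
  rw [sq_abs] at this
  rw [hαi] at hle
  linarith

theorem limit_eq_sign_mul_abs (h : IsVolterraPath n a) {α : ℕ → ℝ}
    (hα : ∀ i, Tendsto (fun t => a t i) atTop (𝓝 (α i))) (i : ℕ) :
    α i = Real.sign (a 0 i) * |α i| :=
  tendsto_nhds_unique (hα i) <|
    ((hα i).abs.const_mul (Real.sign (a 0 i))).congr fun t => (h.eq_sign_mul_abs t i).symm

theorem solvesOn (h : IsVolterraPath n a) : SolvesOn (fun t => symDiag n 1 (a t)) univ := by
  intro t _
  rw [lie_symDiag_skewK (h.zero_left t) (h.zero_right t), hasDerivWithinAt_matrix]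
  intro i j
  simp only [symDiag_apply]
  refine HasDerivWithinAt.fun_add ?_ ?_ <;> split_ifs <;>
    first | exact (h.deriv t _).hasDerivWithinAt | exact hasDerivWithinAt_const ..

end IsVolterraPath

end Volterra

/-! ### The flow -/

section VolterraFlow

/-- The sequence `0, x₁, …, xₙ₋₁, 0, 0, …`. -/
def extendZero (n : ℕ) (x : EuclideanSpace ℝ (Fin (n - 1))) (i : ℕ) : ℝ :=
  if h : 1 ≤ i ∧ i < n then x ⟨i - 1, by omega⟩ else 0

/-- The Volterra vector field in coordinates. -/
noncomputable def volterraVector (n : ℕ) (x : EuclideanSpace ℝ (Fin (n - 1))) :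
    EuclideanSpace ℝ (Fin (n - 1)) :=
  WithLp.toLp 2 fun k => volterraField (extendZero n x) (k + 1)

theorem extendZero_zero (n : ℕ) (x : EuclideanSpace ℝ (Fin (n - 1))) : extendZero n x 0 = 0 := by
  simp [extendZero]

theorem extendZero_of_le {n i : ℕ} (x : EuclideanSpace ℝ (Fin (n - 1))) (hi : n ≤ i) :
    extendZero n x i = 0 := by
  rw [extendZero, dif_neg (by omega)]

theorem extendZero_succ {n : ℕ} (x : EuclideanSpace ℝ (Fin (n - 1))) (k : Fin (n - 1)) :
    extendZero n x (k + 1) = x k := by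
  have := k.2
  rw [extendZero, dif_pos (by omega)]
  rfl

theorem contDiff_extendZero (n i : ℕ) : ContDiff ℝ 1 fun x => extendZero n x i := by
  unfold extendZero
  split_ifs with h
  · exact contDiff_piLp_apply 2
  · exact contDiff_const

theorem contDiff_volterraVector (n : ℕ) : ContDiff ℝ 1 (volterraVector n) := by
  refine (contDiff_piLp 2).2 fun k => ?_
  exact (contDiff_extendZero n _).mul
    (((contDiff_extendZero n _).pow 2).sub ((contDiff_extendZero n _).pow 2))

theorem inner_volterraVector (n : ℕ) (x : EuclideanSpace ℝ (Fin (n - 1))) :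
    inner ℝ x (volterraVector n x) = 0 := by
  have h := sum_mul_volterraField (extendZero_zero n x) (n - 1)
  rw [Finset.sum_range_succ', extendZero_zero, extendZero_of_le x (by omega : n ≤ n - 1 + 1),
    ← Fin.sum_univ_eq_sum_range
      (fun k => 2 * extendZero n x (k + 1) * volterraField (extendZero n x) (k + 1))] at h
  simp only [extendZero_succ, mul_assoc, ← Finset.mul_sum] at h
  simp only [PiLp.inner_apply, volterraVector, RCLike.inner_apply, conj_trivial]
  simp only [mul_comm (volterraField _ _)]
  linarith

theorem exists_volterraFlow (n : ℕ) : ∃ φ : Flow ℝ (EuclideanSpace ℝ (Fin (n - 1))),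
    ∀ x, IsVolterraPath n fun t => extendZero n (φ t x) := by
  obtain ⟨φ, hφ⟩ := exists_flow_of_inner_eq_zero (contDiff_volterraVector n)
    (inner_volterraVector n)
  refine ⟨φ, fun x => ⟨fun t => extendZero_zero n _, fun t i hi => extendZero_of_le _ hi,
    fun t i => ?_⟩⟩
  by_cases hi : 1 ≤ i ∧ i < n
  · obtain ⟨k, rfl⟩ : ∃ k : Fin (n - 1), i = k + 1 :=
      ⟨⟨i - 1, by omega⟩, (Nat.sub_add_cancel hi.1).symm⟩
    simp only [extendZero_succ]
    exact hasDerivAt_pi.1 ((PiLp.continuousLinearEquiv 2 ℝ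
      (fun _ : Fin (n - 1) => ℝ)).hasFDerivAt.comp_hasDerivAt t (hφ x t)) k
  · have hz : ∀ y, extendZero n y i = 0 := fun y => by rw [extendZero, dif_neg hi]
    simp only [volterraField, hz, zero_mul]
    exact hasDerivAt_const t 0

/-- The coordinates `(a₁, …, aₙ₋₁)` of a zero-diagonal Jacobi matrix. -/
noncomputable def superCoord {n : ℕ} (H : Matrix (Fin n) (Fin n) ℝ) :
    EuclideanSpace ℝ (Fin (n - 1)) :=
  WithLp.toLp 2 fun k => superEntry H (k + 1)

theorem extendZero_superCoord {n : ℕ} (H : Matrix (Fin n) (Fin n) ℝ) :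
    extendZero n (superCoord H) = superEntry H := by
  ext i
  rw [extendZero]
  split_ifs with h
  · simp [superCoord, Nat.sub_add_cancel h.1]
  · rw [superEntry, dif_neg h]

theorem superCoord_symDiag_extendZero {n : ℕ} (x : EuclideanSpace ℝ (Fin (n - 1))) :
    superCoord (symDiag n 1 (extendZero n x)) = x := by
  ext k
  simp only [superCoord]
  rw [superEntry_symDiag_of_boundary (extendZero_zero n x) (fun i => extendZero_of_le x),
    extendZero_succ]

theorem continuous_superCoord (n : ℕ) :
    Continuous (superCoord : Matrix (Fin n) (Fin n) ℝ → _) := by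
  refine (PiLp.continuous_toLp 2 _).comp (continuous_pi fun k => ?_)
  unfold superEntry
  split_ifs with h
  · exact continuous_id.matrix_elem _ _
  · exact continuous_const

theorem continuous_symDiag {X : Type*} [TopologicalSpace X] {n : ℕ} {f : X → ℕ → ℝ}
    (hf : ∀ i, Continuous fun x => f x i) : Continuous fun x => symDiag n 1 (f x) := by
  refine continuous_matrix fun i j => ?_
  simp only [symDiag_apply]
  refine Continuous.add ?_ ?_ <;> split_ifs <;> first | exact hf _ | exact continuous_const

theorem IsVolterraPath.mem_jacobiZero {n : ℕ} {a : ℝ → ℕ → ℝ} (h : IsVolterraPath n a)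
    (h0 : symDiag n 1 (a 0) ∈ jacobiZero n) (t : ℝ) : symDiag n 1 (a t) ∈ jacobiZero n := by
  rw [symDiag_mem_jacobiZero_iff] at *
  rwa [h.solvesOn.spectrum_eq t 0]

theorem exists_jacobiFlow (n : ℕ) : ∃ φ : Flow ℝ (jacobiZero n), ∀ H₀ : jacobiZero n,
    ∃ a : ℝ → ℕ → ℝ, IsVolterraPath n a ∧ a 0 = superEntry (H₀ : Matrix (Fin n) (Fin n) ℝ) ∧
      ∀ t, (φ t H₀ : Matrix (Fin n) (Fin n) ℝ) = symDiag n 1 (a t) := by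
  obtain ⟨φ, hφ⟩ := exists_volterraFlow n
  have h0 : ∀ H : jacobiZero n, extendZero n (φ 0 (superCoord (H : Matrix (Fin n) (Fin n) ℝ))) =
      superEntry (H : Matrix (Fin n) (Fin n) ℝ) := fun H => by
    rw [φ.map_zero_apply, extendZero_superCoord]
  have hmem : ∀ (t : ℝ) (H : jacobiZero n), symDiag n 1
      (extendZero n (φ t (superCoord (H : Matrix (Fin n) (Fin n) ℝ)))) ∈ jacobiZero n :=
    fun t H => (hφ (superCoord (H : Matrix (Fin n) (Fin n) ℝ))).mem_jacobiZero
      (by rw [h0, symDiag_superEntry H.2]; exact H.2) t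
  refine ⟨⟨fun t H => ⟨_, hmem t H⟩, ?_, fun s t H => Subtype.ext ?_, fun H => Subtype.ext ?_⟩,
    fun H => ⟨_, hφ (superCoord (H : Matrix (Fin n) (Fin n) ℝ)), h0 H, fun t => rfl⟩⟩
  · refine Continuous.subtype_mk (continuous_symDiag fun i => ?_) _
    exact (contDiff_extendZero n i).continuous.comp <| φ.continuous continuous_fst
      ((continuous_superCoord n).comp (continuous_subtype_val.comp continuous_snd))
  · simp only [superCoord_symDiag_extendZero, φ.map_add]
  · simp only [h0, symDiag_superEntry H.2]

end VolterraFlow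

/-! ### Equilibria and limits -/

section Limit

theorem skewK_eq_zero {n : ℕ} {H : Matrix (Fin n) (Fin n) ℝ}
    (h : ∀ i, superEntry H i * superEntry H (i + 1) = 0) : skewK H = 0 := by
  ext i j
  simp [skewK_apply, h]

theorem lie_skewK_eq_zero_iff {n : ℕ} {H : Matrix (Fin n) (Fin n) ℝ} (hH : H ∈ jacobiZero n) :
    ⁅H, skewK H⁆ = 0 ↔ skewK H = 0 := by
  refine ⟨fun h => skewK_eq_zero fun i => ?_, fun h => by rw [h, Ring.lie_def]; simp⟩
  have h0 := superEntry_zero H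
  have hn : ∀ i, n ≤ i → superEntry H i = 0 := fun i hi => superEntry_of_le H hi
  rw [← symDiag_superEntry hH, lie_symDiag_skewK h0 hn] at h
  have hv : ∀ i, volterraField (superEntry H) i = 0 := by
    intro i
    rw [← superEntry_symDiag_of_boundary (n := n) (a := volterraField (superEntry H))
      (by simp [volterraField, h0]) (fun i hi => by simp [volterraField, hn i hi]) i, h]
    simp [superEntry]
  have hs := sum_mul_volterraField h0 i
  simp only [hv, mul_zero, Finset.sum_const_zero] at hs
  have h2 : (superEntry H i * superEntry H (i + 1)) ^ 2 = 0 := by linarith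
  exact pow_eq_zero_iff two_ne_zero |>.1 h2

/-- Being an eigenvalue is the vanishing of a determinant, a closed condition on the matrix. -/
theorem spectrum_subset_of_tendsto {n : ℕ} {H : ℝ → Matrix (Fin n) (Fin n) ℝ}
    {E : Matrix (Fin n) (Fin n) ℝ} {S : Set ℝ} (hS : ∀ t, S ⊆ spectrum ℝ (H t))
    (hE : Tendsto H atTop (𝓝 E)) : S ⊆ spectrum ℝ E := by
  intro x hx
  have key : ∀ A : Matrix (Fin n) (Fin n) ℝ,
      x ∈ spectrum ℝ A ↔ (Matrix.scalar (Fin n) x - A).det = 0 := fun A => by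
    rw [Matrix.mem_spectrum_iff_isRoot_charpoly, Polynomial.IsRoot, Matrix.eval_charpoly]
  have hc : Continuous fun A : Matrix (Fin n) (Fin n) ℝ => (Matrix.scalar (Fin n) x - A).det :=
    (continuous_const.sub continuous_id).matrix_det
  rw [key]
  refine tendsto_nhds_unique ((hc.tendsto E).comp hE) (tendsto_const_nhds.congr fun t => ?_)
  exact ((key _).1 (hS t hx)).symm

theorem continuous_frobNorm (n : ℕ) : Continuous (frobNorm : Matrix (Fin n) (Fin n) ℝ → ℝ) :=
  (continuous_id.matrix_mul continuous_id.matrix_transpose).matrix_trace.sqrt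

theorem tendsto_symDiag {n : ℕ} {a : ℝ → ℕ → ℝ} {α : ℕ → ℝ}
    (hα : ∀ i, Tendsto (fun t => a t i) atTop (𝓝 (α i))) :
    Tendsto (fun t => symDiag n 1 (a t)) atTop (𝓝 (symDiag n 1 α)) := by
  refine tendsto_pi_nhds.2 fun i => tendsto_pi_nhds.2 fun j => ?_
  simp only [symDiag_apply]
  refine Tendsto.add ?_ ?_ <;> split_ifs <;> first | exact hα _ | exact tendsto_const_nhds

/-- The properties of the super-diagonal `α` of the limit of the solution that starts at the
zero-diagonal Jacobi matrix with super-diagonal `a`. -/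
structure IsLimitSeq (n : ℕ) (a α : ℕ → ℝ) : Prop where
  zero_left : α 0 = 0
  zero_right : ∀ i, n ≤ i → α i = 0
  mul_succ : ∀ i, α i * α (i + 1) = 0
  sign : ∀ i, α i = Real.sign (a i) * |α i|
  sq_le : ∀ i, a i ≠ 0 → α i = 0 → α (i - 1) ^ 2 ≤ α (i + 1) ^ 2
  spectrum_eq : spectrum ℝ (symDiag n 1 α) = spectrum ℝ (symDiag n 1 a)

theorem IsVolterraPath.isLimitSeq {n : ℕ} {a : ℝ → ℕ → ℝ} (h : IsVolterraPath n a)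
    (h0 : symDiag n 1 (a 0) ∈ jacobiZero n) {α : ℕ → ℝ}
    (hα : ∀ i, Tendsto (fun t => a t i) atTop (𝓝 (α i))) : IsLimitSeq n (a 0) α where
  zero_left := tendsto_nhds_unique (hα 0) (by simp [h.zero_left])
  zero_right i hi := tendsto_nhds_unique (hα i) (by simp [h.zero_right _ i hi])
  mul_succ := h.limit_mul_eq_zero hα
  sign := h.limit_eq_sign_mul_abs hα
  sq_le _ := h.limit_sq_le hα
  spectrum_eq := by
    have hsub := spectrum_subset_of_tendsto (fun t => (h.solvesOn.spectrum_eq 0 t).subset)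
      (tendsto_symDiag (n := n) hα)
    -- The inclusion is an equality because the initial spectrum already has the maximal number `n`
    -- of elements.
    refine (Set.eq_of_subset_of_ncard_le hsub ?_ (spectrum_finite _)).symm
    rw [ncard_spectrum_of_mem_jacobiZero h0]
    exact ncard_spectrum_le _

theorem exists_isLimitSeq {n : ℕ} {H₀ : Matrix (Fin n) (Fin n) ℝ} (hH₀ : H₀ ∈ jacobiZero n) :
    ∃ α, IsLimitSeq n (superEntry H₀) α ∧ ∀ H : ℝ → Matrix (Fin n) (Fin n) ℝ, H 0 = H₀ →
      SolvesOn H (Ici 0) → Tendsto H atTop (𝓝 (symDiag n 1 α)) := by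
  obtain ⟨φ, hφ⟩ := exists_jacobiFlow n
  obtain ⟨a, ha, ha0, -⟩ := hφ ⟨H₀, hH₀⟩
  choose α hα using ha.exists_tendsto
  have h0 : symDiag n 1 (a 0) = H₀ := by rw [ha0]; exact symDiag_superEntry hH₀
  refine ⟨α, ha0 ▸ ha.isLimitSeq (h0 ▸ hH₀) hα, fun H hH hs => ?_⟩
  refine (tendsto_symDiag hα).congr' ?_
  filter_upwards [eventually_ge_atTop 0] with t ht
  exact SolvesOn.eqOn ordConnected_Ici (mem_Ici.2 le_rfl) (ha.solvesOn.mono (subset_univ _)) hs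
    (h0.trans hH.symm) ht

end Limit

/-! ### The spectrum of the limit -/

section LimitSpectrum

theorem exists_eigenvector_of_mem_spectrum {n : ℕ} {A : Matrix (Fin n) (Fin n) ℝ} {x : ℝ}
    (hx : x ∈ spectrum ℝ A) : ∃ v : Fin n → ℝ, v ≠ 0 ∧ A.mulVec v = x • v := by
  rw [← Matrix.spectrum_toLin', ← Module.End.hasEigenvalue_iff_mem_spectrum] at hx
  obtain ⟨v, hv⟩ := hx.exists_hasEigenvector
  exact ⟨v, hv.2, by simpa using hv.apply_eq_smul⟩

theorem IsLimitSeq.eq_zero_of_even_sub {n : ℕ} {a α : ℕ → ℝ} (h : IsLimitSeq n a α)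
    (ha : ∀ i, 2 ≤ i → i ≤ n - 1 → a i ≠ 0) (j : ℕ) (hj : 2 * j ≤ n) : α (n - 2 * j) = 0 := by
  induction j with
  | zero => exact h.zero_right _ (by simp)
  | succ j ih =>
    obtain ⟨i, hi⟩ : ∃ i, n = i + 2 * (j + 1) := ⟨n - 2 * (j + 1), by omega⟩
    have e1 : n - 2 * j = i + 2 := by omega
    have e2 : n - 2 * (j + 1) = i := by omega
    have ih' := ih (by omega)
    rw [e1] at ih'
    rw [e2]
    by_contra hne
    have h1 : α (i + 1) = 0 := (mul_eq_zero.1 (h.mul_succ i)).resolve_left hne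
    have hi0 : i ≠ 0 := fun h0 => hne (h0 ▸ h.zero_left)
    -- Here `i ≥ 1`, so only entries of index at least `2` must be nonzero; `a 1` is never used.
    have h2 := h.sq_le (i + 1) (ha _ (by omega) (by omega)) h1
    rw [Nat.add_sub_cancel, ih', zero_pow two_ne_zero] at h2
    exact hne (pow_eq_zero_iff two_ne_zero |>.1 (le_antisymm h2 (sq_nonneg _)))

theorem IsLimitSeq.eq_zero_of_mod {n : ℕ} {a α : ℕ → ℝ} (h : IsLimitSeq n a α)
    (ha : ∀ i, 2 ≤ i → i ≤ n - 1 → a i ≠ 0) {i : ℕ} (hi : i % 2 = n % 2) : α i = 0 := by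
  rcases le_total n i with hni | hni
  · exact h.zero_right i hni
  · have := h.eq_zero_of_even_sub ha ((n - i) / 2) (by omega)
    rwa [show n - 2 * ((n - i) / 2) = i by omega] at this

/-- If every second off-diagonal entry vanishes, the eigenvalues are those of the diagonal
`2 × 2` blocks, and `0` if the size is odd. -/
theorem spectrum_symDiag_subset {n : ℕ} {α : ℕ → ℝ} (h0 : α 0 = 0) (hn : ∀ i, n ≤ i → α i = 0)
    (hα : ∀ i, i % 2 = n % 2 → α i = 0) {x : ℝ} (hx : x ∈ spectrum ℝ (symDiag n 1 α)) :
    (n % 2 = 1 ∧ x = 0) ∨ ∃ k ∈ Finset.Icc 1 (n / 2), x ^ 2 = α (2 * k - 1 + n % 2) ^ 2 := by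
  obtain ⟨v, hv0, hv⟩ := exists_eigenvector_of_mem_spectrum hx
  let w : ℕ → ℝ := fun i => if h : i < n then v ⟨i, h⟩ else 0
  have hw : ∀ i, i < n → α i * w (i - 1) + α (i + 1) * w (i + 1) = x * w i := by
    intro i hi
    have h1 := congrFun hv ⟨i, hi⟩
    have h2 := sum_symDiag_mul h0 hn w ⟨i, hi⟩
    simp only [Matrix.mulVec, dotProduct, Pi.smul_apply, smul_eq_mul] at h1
    rw [← h2]
    simpa [w, hi] using h1
  obtain ⟨⟨i, hi⟩, hvi⟩ := Function.ne_iff.1 hv0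
  have hwi : w i ≠ 0 := by simpa [w, hi] using hvi
  -- Parity decides whether row `i` is the upper row of its block, coupled to `i + 1`, or the lower
  -- one, coupled to `i - 1`; a lower row `0` is the `1 × 1` block for odd `n`.
  rcases Nat.eq_zero_or_pos ((i + n) % 2) with hp | hp
  · right
    have e1 := hw i hi
    have e2 := hw (i + 1) (by omega)
    rw [hα i (by omega), zero_mul, zero_add] at e1
    rw [hα (i + 1 + 1) (by omega), zero_mul, add_zero, Nat.add_sub_cancel] at e2
    refine ⟨(i + 2 - n % 2) / 2, Finset.mem_Icc.2 (by omega), mul_right_cancel₀ hwi ?_⟩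
    rw [show 2 * ((i + 2 - n % 2) / 2) - 1 + n % 2 = i + 1 by omega]
    -- The two rows of the block exchange `w i` and `w (i + 1)` up to the factor `α (i + 1)`;
    -- eliminating `w (i + 1)` leaves `x² = α²`.
    linear_combination (-x) * e1 - α (i + 1) * e2
  · have e1 := hw i hi
    rw [hα (i + 1) (by omega), zero_mul, add_zero] at e1
    rcases i with _ | i
    · left
      rw [h0, zero_mul] at e1
      exact ⟨by omega, (mul_eq_zero.1 e1.symm).resolve_right hwi⟩
    · right
      have e2 := hw i (by omega)
      rw [hα i (by omega), zero_mul, zero_add] at e2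
      rw [Nat.add_sub_cancel] at e1
      refine ⟨(i + 2 - n % 2) / 2, Finset.mem_Icc.2 (by omega), mul_right_cancel₀ hwi ?_⟩
      rw [show 2 * ((i + 2 - n % 2) / 2) - 1 + n % 2 = i + 1 by omega]
      linear_combination (-x) * e1 - α (i + 1) * e2

/-- A set of `2 m + r` reals that consists of the values `± c k`, `1 ≤ k ≤ m`, and
possibly of `0` if `r = 1`, contains all of these, and they are distinct. -/
theorem eq_and_injOn_of_ncard {S : Set ℝ} {c : ℕ → ℝ} {m r : ℕ}
    (hS : ∀ x ∈ S, (r = 1 ∧ x = 0) ∨ ∃ k ∈ Finset.Icc 1 m, x = c k ∨ x = -c k)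
    (hcard : S.ncard = 2 * m + r) :
    S = {x | (r = 1 ∧ x = 0) ∨ ∃ k ∈ Finset.Icc 1 m, x = c k ∨ x = -c k} ∧
      InjOn c (Finset.Icc 1 m) ∧ ∀ k ∈ Finset.Icc 1 m, c k ≠ 0 := by
  classical
  let Z : Finset ℝ := if r = 1 then {0} else ∅
  have hZ : Z.card ≤ r := by
    simp only [Z]
    split_ifs with h
    · simp [h]
    · simp
  let P := (Finset.Icc 1 m).image c
  have hm : (Finset.Icc 1 m).card = m := by simp
  have hP : P.card ≤ m := Finset.card_image_le.trans hm.le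
  -- There are at most `2 m + r` candidates for as many elements, so any coincidence among them
  -- contradicts the count.
  have bound : ∀ N : Finset ℝ, S ⊆ ↑(Z ∪ P ∪ N) → 2 * m + r ≤ r + P.card + N.card := by
    intro N hN
    have h1 := Set.ncard_le_ncard hN (Finset.finite_toSet _)
    rw [Set.ncard_coe_finset, hcard] at h1
    have h2 := Finset.card_union_le (Z ∪ P) N
    have h3 := Finset.card_union_le Z P
    omega
  have memZ : ∀ x, (r = 1 ∧ x = 0) ↔ x ∈ Z := fun x => by
    simp only [Z]
    split_ifs with h <;> simp [h]
  have hcover : S ⊆ ↑(Z ∪ P ∪ (Finset.Icc 1 m).image fun k => -c k) := by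
    intro x hx
    simp only [Finset.coe_union, mem_union, Finset.mem_coe, Finset.mem_image, P]
    rcases hS x hx with h | ⟨k, hk, h | h⟩
    · exact Or.inl (Or.inl ((memZ x).1 h))
    · exact Or.inl (Or.inr ⟨k, hk, h.symm⟩)
    · exact Or.inr ⟨k, hk, h.symm⟩
  have hN : ((Finset.Icc 1 m).image fun k => -c k).card ≤ m :=
    Finset.card_image_le.trans hm.le
  have hb := bound _ hcover
  refine ⟨?_, ?_, ?_⟩
  · have heq : S = ↑(Z ∪ P ∪ (Finset.Icc 1 m).image fun k => -c k) := by
      refine Set.eq_of_subset_of_ncard_le hcover ?_ (Finset.finite_toSet _)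
      rw [Set.ncard_coe_finset, hcard]
      have h2 := Finset.card_union_le (Z ∪ P) ((Finset.Icc 1 m).image fun k => -c k)
      have h3 := Finset.card_union_le Z P
      omega
    refine Set.Subset.antisymm hS fun x hx => ?_
    rw [heq]
    simp only [Finset.coe_union, mem_union, Finset.mem_coe, Finset.mem_image, P]
    rcases hx with h | ⟨k, hk, h | h⟩
    · exact Or.inl (Or.inl ((memZ x).1 h))
    · exact Or.inl (Or.inr ⟨k, hk, h.symm⟩)
    · exact Or.inr ⟨k, hk, h.symm⟩
  · exact Finset.card_image_iff.1 (show P.card = (Finset.Icc 1 m).card by omega)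
  · intro k hk hck
    -- If `c k = 0`, then `-c k` is already among the values of `c`, so it can be dropped from the
    -- negatives.
    have hcover' : S ⊆ ↑(Z ∪ P ∪ ((Finset.Icc 1 m).erase k).image fun k => -c k) := by
      intro x hx
      simp only [Finset.coe_union, mem_union, Finset.mem_coe, Finset.mem_image, P]
      rcases hS x hx with h | ⟨l, hl, h | h⟩
      · exact Or.inl (Or.inl ((memZ x).1 h))
      · exact Or.inl (Or.inr ⟨l, hl, h.symm⟩)
      · rcases eq_or_ne l k with rfl | hlk
        · exact Or.inl (Or.inr ⟨l, hl, by rw [h, hck, neg_zero]⟩)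
        · exact Or.inr ⟨l, Finset.mem_erase.2 ⟨hlk, hl⟩, h.symm⟩
    have hb' := bound _ hcover'
    have h4 : (((Finset.Icc 1 m).erase k).image fun k => -c k).card ≤ m - 1 := by
      refine Finset.card_image_le.trans ?_
      rw [Finset.card_erase_of_mem hk, hm]
    have := Finset.mem_Icc.1 hk
    omega

theorem IsLimitSeq.strictMonoOn_and_spectrum {n : ℕ} {a α : ℕ → ℝ} (h : IsLimitSeq n a α)
    (ha : ∀ i, 2 ≤ i → i ≤ n - 1 → a i ≠ 0) (hJ : symDiag n 1 a ∈ jacobiZero n) :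
    StrictMonoOn (fun k => |α (2 * k - 1 + n % 2)|) (Icc 1 (n / 2)) ∧
      (∀ k ∈ Icc 1 (n / 2), 0 < |α (2 * k - 1 + n % 2)|) ∧
      spectrum ℝ (symDiag n 1 a) = {x | (n % 2 = 1 ∧ x = 0) ∨
        ∃ k ∈ Icc 1 (n / 2), x = |α (2 * k - 1 + n % 2)| ∨ x = -|α (2 * k - 1 + n % 2)|} := by
  have hcard := ncard_spectrum_of_mem_jacobiZero hJ
  have hzero : ∀ i, i % 2 = n % 2 → α i = 0 := fun i hi => h.eq_zero_of_mod ha hi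
  obtain ⟨h1, h2, h3⟩ := eq_and_injOn_of_ncard (S := spectrum ℝ (symDiag n 1 a))
    (c := fun k => |α (2 * k - 1 + n % 2)|) (m := n / 2) (r := n % 2)
    (fun x hx => by
      rw [← h.spectrum_eq] at hx
      refine (spectrum_symDiag_subset h.zero_left h.zero_right hzero hx).imp_right ?_
      rintro ⟨k, hk, hxk⟩
      refine ⟨k, hk, ?_⟩
      rwa [← sq_eq_sq_iff_eq_or_eq_neg, sq_abs])
    (by omega)
  rw [Finset.coe_Icc] at h2
  refine ⟨?_, fun k hk => (abs_nonneg _).lt_of_ne' (h3 k (Finset.mem_Icc.2 hk)), ?_⟩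
  · have hmono : MonotoneOn (fun k => |α (2 * k - 1 + n % 2)|) (Icc 1 (n / 2)) := by
      intro k hk l hl hkl
      induction l, hkl using Nat.le_induction with
      | base => exact le_rfl
      | succ l hkl ih =>
        have hk1 := hk.1
        have hl2 := hl.2
        refine (ih ⟨hk1.trans hkl, by omega⟩).trans (sq_le_sq.1 ?_)
        -- This index is the vanishing entry between blocks `l` and `l + 1`; strictness comes later,
        -- from injectivity.
        have := h.sq_le (2 * l + n % 2) (ha _ (by omega) (by omega)) (hzero _ (by omega))
        rwa [show 2 * l + n % 2 - 1 = 2 * l - 1 + n % 2 by omega,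
          show 2 * l + n % 2 + 1 = 2 * (l + 1) - 1 + n % 2 by omega] at this
    exact fun k hk l hl hkl => (hmono hk hl hkl.le).lt_of_ne fun he => hkl.ne (h2 hk hl he)
  · rw [h1]
    simp only [Finset.mem_Icc, mem_Icc]

theorem StrictMonoOn.eqOn_of_image_eq {s : Set ℕ} {f g : ℕ → ℝ} (hf : StrictMonoOn f s)
    (hg : StrictMonoOn g s) (h : f '' s = g '' s) : EqOn f g s := by
  have := (StrictMono.range_inj (strictMonoOn_iff_strictMono.1 hf)
    (strictMonoOn_iff_strictMono.1 hg)).1 (by simpa only [image_eq_range] using h)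
  exact fun x hx => congrFun this ⟨x, hx⟩

/-- The absolute values in a spectrum `{± l k}` (together with `0`, if `r = 1`) are determined
by the spectrum. -/
theorem image_abs_eq_of_spectrum {S : Set ℝ} {l : ℕ → ℝ} {I : Set ℕ} {p : Prop}
    (hl : ∀ k ∈ I, 0 < |l k|)
    (hS : S = {x | (p ∧ x = 0) ∨ ∃ k ∈ I, x = l k ∨ x = -l k}) :
    (fun k => |l k|) '' I = {y | 0 < y ∧ y ∈ S} := by
  subst hS
  ext y
  constructor
  · rintro ⟨k, hk, rfl⟩
    exact ⟨hl k hk, Or.inr ⟨k, hk, abs_choice _⟩⟩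
  · rintro ⟨hy, ⟨-, rfl⟩ | ⟨k, hk, h⟩⟩
    · exact absurd hy (lt_irrefl _)
    · refine ⟨k, hk, ?_⟩
      rw [← abs_of_pos hy]
      exact (abs_eq_abs.2 h).symm

theorem IsLimitSeq.eqOn_abs {n : ℕ} {a α : ℕ → ℝ} (h : IsLimitSeq n a α)
    (ha : ∀ i, 2 ≤ i → i ≤ n - 1 → a i ≠ 0) (hJ : symDiag n 1 a ∈ jacobiZero n) {l : ℕ → ℝ}
    (hl : StrictMonoOn (fun k => |l k|) (Icc 1 (n / 2)))
    (hS : spectrum ℝ (symDiag n 1 a) = {x | (n % 2 = 1 ∧ x = 0) ∨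
        ∃ k ∈ Icc 1 (n / 2), x = l k ∨ x = -l k}) :
    ∀ k ∈ Icc 1 (n / 2), |α (2 * k - 1 + n % 2)| = |l k| := by
  -- Counting eigenvalues forces all `l k ≠ 0`, also for even `n`, where positivity is not assumed.
  obtain ⟨-, -, hl0⟩ := eq_and_injOn_of_ncard (S := spectrum ℝ (symDiag n 1 a)) (c := l)
    (m := n / 2) (r := n % 2)
    (fun x hx => by rw [hS] at hx; simpa only [mem_ofPred_eq, Finset.mem_Icc, mem_Icc] using hx)
    (by rw [ncard_spectrum_of_mem_jacobiZero hJ]; omega)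
  obtain ⟨h1, h2, h3⟩ := h.strictMonoOn_and_spectrum ha hJ
  refine h1.eqOn_of_image_eq hl ?_
  rw [image_abs_eq_of_spectrum (I := Icc 1 (n / 2))
      (fun k hk => abs_pos.2 (hl0 k (Finset.mem_Icc.2 hk))) hS,
    ← image_abs_eq_of_spectrum (I := Icc 1 (n / 2))
      (l := fun k => |α (2 * k - 1 + n % 2)|) (fun k hk => by rw [abs_abs]; exact h2 k hk) h3]
  simp only [abs_abs]

/-- The offset `n % 2` treats both parities at once: `(i + 1 - n % 2) / 2` is the number of the
block containing the entry `i`. -/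
theorem exists_spectrum_and_tendsto {n : ℕ} {a : ℕ → ℝ} (hJ : symDiag n 1 a ∈ jacobiZero n)
    (ha : ∀ i, 2 ≤ i → i ≤ n - 1 → a i ≠ 0) :
    (∃ l : ℕ → ℝ, StrictMonoOn (fun k => |l k|) (Icc 1 (n / 2)) ∧
      (∀ k ∈ Icc 1 (n / 2), 0 < |l k|) ∧
      spectrum ℝ (symDiag n 1 a) = {x | (n % 2 = 1 ∧ x = 0) ∨
        ∃ k ∈ Icc 1 (n / 2), x = l k ∨ x = -l k}) ∧
    ∀ l : ℕ → ℝ, StrictMonoOn (fun k => |l k|) (Icc 1 (n / 2)) →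
      spectrum ℝ (symDiag n 1 a) = {x | (n % 2 = 1 ∧ x = 0) ∨
        ∃ k ∈ Icc 1 (n / 2), x = l k ∨ x = -l k} →
      ∀ H : ℝ → Matrix (Fin n) (Fin n) ℝ, H 0 = symDiag n 1 a → SolvesOn H (Ici 0) →
        Tendsto H atTop (𝓝 (symDiag n 1 fun i =>
          if i % 2 = n % 2 then 0 else Real.sign (a i) * |l ((i + 1 - n % 2) / 2)|)) := by
  obtain ⟨α, hα, hlim⟩ := exists_isLimitSeq hJ
  -- The values of `a` outside `1, …, n - 1` are arbitrary; `b` replaces them by zeros without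
  -- changing the matrix.
  set b := superEntry (symDiag n 1 a) with hb
  have hba : ∀ i, 1 ≤ i → i < n → b i = a i := fun i h1 h2 => by
    rw [hb, superEntry_symDiag, if_pos ⟨h1, h2⟩]
  have hb0 : ∀ i, 2 ≤ i → i ≤ n - 1 → b i ≠ 0 := fun i h1 h2 => by
    rw [hba i (by omega) (by omega)]
    exact ha i h1 h2
  rw [symDiag_congr (fun i h1 h2 => (hba i h1 h2).symm)] at hJ ⊢
  obtain ⟨h1, h2, h3⟩ := hα.strictMonoOn_and_spectrum hb0 hJ
  refine ⟨⟨_, by simpa only [abs_abs] using h1, by simpa only [abs_abs] using h2, h3⟩, ?_⟩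
  intro l hl hS H hH hs
  have hαl := hα.eqOn_abs hb0 hJ hl hS
  rw [symDiag_congr hba] at hH
  convert hlim H hH hs using 2
  refine symDiag_congr fun i hi hin => ?_
  split_ifs with hp
  · exact (hα.eq_zero_of_mod hb0 hp).symm
  · rw [hα.sign i, hba i hi hin, ← hαl _ (mem_Icc.2 (by omega)),
      show 2 * ((i + 1 - n % 2) / 2) - 1 + n % 2 = i by omega]

end LimitSpectrum

theorem theorem1 (n : ℕ) (hn : 0 < n) :
    -- (i) the equation defines an isospectral flow on the zero-diagonal Jacobi matrices
    (∃ φ : Flow ℝ (jacobiZero n),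
      (∀ H₀ : jacobiZero n, SolvesOn (fun t => (φ t H₀ : Matrix (Fin n) (Fin n) ℝ)) univ) ∧
      (∀ (t : ℝ) (H₀ : jacobiZero n),
        spectrum ℝ (φ t H₀ : Matrix (Fin n) (Fin n) ℝ) =
          spectrum ℝ (H₀ : Matrix (Fin n) (Fin n) ℝ)) ∧
      (∀ (I : Set ℝ) (H : ℝ → Matrix (Fin n) (Fin n) ℝ) (H₀ : jacobiZero n),
        I.OrdConnected → (0 : ℝ) ∈ I → SolvesOn H I → H 0 = H₀ →
          ∀ t ∈ I, H t = φ t H₀)) ∧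
    -- (ii) global existence, the equilibria, and convergence to the set of equilibria
    (∀ H₀ ∈ jacobiZero n,
      (∃ H : ℝ → Matrix (Fin n) (Fin n) ℝ, H 0 = H₀ ∧ SolvesOn H (Ici 0)) ∧
      {E | E ∈ isospectralJacobi H₀ ∧ ⁅E, skewK E⁆ = 0} =
        {E | E ∈ isospectralJacobi H₀ ∧ skewK E = 0} ∧
      (∀ H : ℝ → Matrix (Fin n) (Fin n) ℝ, H 0 = H₀ → SolvesOn H (Ici 0) →
        ∀ ε > 0, ∀ᶠ t in atTop,
          ∃ E ∈ {E | E ∈ isospectralJacobi H₀ ∧ skewK E = 0}, frobNorm (H t - E) < ε)) ∧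
    -- (iii) existence of the limit
    (∀ H : ℝ → Matrix (Fin n) (Fin n) ℝ, H 0 ∈ jacobiZero n → SolvesOn H (Ici 0) →
      ∃ L : Matrix (Fin n) (Fin n) ℝ, Tendsto H atTop (𝓝 L)) ∧
    -- (iv) the limit, for even and for odd `n`
    (Even n → ∀ a : ℕ → ℝ, symDiag n 1 a ∈ jacobiZero n →
      (∀ i, 2 ≤ i → i ≤ n - 1 → a i ≠ 0) →
      (∃ l : ℕ → ℝ, EvenSpectrum (symDiag n 1 a) (n / 2) l) ∧
      ∀ l : ℕ → ℝ, EvenSpectrum (symDiag n 1 a) (n / 2) l →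
        ∀ H : ℝ → Matrix (Fin n) (Fin n) ℝ, H 0 = symDiag n 1 a → SolvesOn H (Ici 0) →
          Tendsto H atTop (𝓝 (symDiag n 1 fun i =>
            if Odd i then Real.sign (a i) * |l ((i + 1) / 2)| else 0))) ∧
    (Odd n → ∀ a : ℕ → ℝ, symDiag n 1 a ∈ jacobiZero n →
      (∀ i, 2 ≤ i → i ≤ n - 1 → a i ≠ 0) →
      (∃ l : ℕ → ℝ, OddSpectrum (symDiag n 1 a) ((n - 1) / 2) l) ∧
      ∀ l : ℕ → ℝ, OddSpectrum (symDiag n 1 a) ((n - 1) / 2) l →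
        ∀ H : ℝ → Matrix (Fin n) (Fin n) ℝ, H 0 = symDiag n 1 a → SolvesOn H (Ici 0) →
          Tendsto H atTop (𝓝 (symDiag n 1 fun i =>
            if Even i then Real.sign (a i) * |l (i / 2)| else 0))) := by
  have hsolves : ∀ {a : ℝ → ℕ → ℝ}, IsVolterraPath n a →
      SolvesOn (fun t => symDiag n 1 (a t)) (Ici 0) :=
    fun ha => ha.solvesOn.mono (subset_univ _)
  refine ⟨?_, fun H₀ hH₀ => ⟨?_, ?_, fun H hH hs ε hε => ?_⟩, fun H hH hs => ?_,
    fun hn2 a hJ ha => ?_, fun hn2 a hJ ha => ?_⟩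
  · obtain ⟨φ, hφ⟩ := exists_jacobiFlow n
    have hsol : ∀ H₀ : jacobiZero n,
        SolvesOn (fun t => (φ t H₀ : Matrix (Fin n) (Fin n) ℝ)) univ := fun H₀ => by
      obtain ⟨a, ha, -, h⟩ := hφ H₀
      simpa only [h] using ha.solvesOn
    refine ⟨φ, hsol, fun t H₀ => ?_, fun I H H₀ hI h0 hs hH => ?_⟩
    · simpa only [φ.map_zero_apply] using (hsol H₀).spectrum_eq t 0
    · exact SolvesOn.eqOn hI h0 hs ((hsol H₀).mono (subset_univ I))
        (by rw [hH, φ.map_zero_apply])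
  · obtain ⟨φ, hφ⟩ := exists_jacobiFlow n
    obtain ⟨a, ha, ha0, -⟩ := hφ ⟨H₀, hH₀⟩
    exact ⟨_, by rw [ha0]; exact symDiag_superEntry hH₀, hsolves ha⟩
  · ext E
    exact and_congr_right fun hE => lie_skewK_eq_zero_iff hE.1
  · obtain ⟨α, hα, hlim⟩ := exists_isLimitSeq hH₀
    have hspec := hα.spectrum_eq
    rw [symDiag_superEntry hH₀] at hspec
    -- The limit itself is an isospectral equilibrium and serves for all large `t`, so the set of
    -- equilibria is also nonempty.
    refine Eventually.mono ?_ fun t ht => ⟨symDiag n 1 α, ⟨⟨?_, hspec⟩, ?_⟩, ht⟩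
    · have hc : Continuous fun A => frobNorm (A - symDiag n 1 α) :=
        (continuous_frobNorm n).comp (continuous_id.sub continuous_const)
      have := (hc.tendsto _).comp (hlim H hH hs)
      refine this.eventually_lt_const ?_
      simpa [frobNorm] using hε
    · rw [symDiag_mem_jacobiZero_iff, hspec, ncard_spectrum_of_mem_jacobiZero hH₀]
    · refine skewK_eq_zero fun i => ?_
      simp only [superEntry_symDiag_of_boundary hα.zero_left hα.zero_right, hα.mul_succ]
  · obtain ⟨α, -, hlim⟩ := exists_isLimitSeq hH
    exact ⟨_, hlim H rfl hs⟩
  · have hr : n % 2 = 0 := Nat.even_iff.1 hn2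
    obtain ⟨⟨l, h1, -, h3⟩, hlim⟩ := exists_spectrum_and_tendsto hJ ha
    simp only [hr, zero_ne_one, false_and, false_or] at h3 hlim
    refine ⟨⟨l, h3, h1⟩, fun l hl H hH hs => ?_⟩
    convert hlim l hl.2 hl.1 H hH hs using 4 with i
    rcases Nat.mod_two_eq_zero_or_one i with hi | hi
    · rw [if_neg (by rw [Nat.odd_iff]; omega), if_pos hi]
    · rw [if_pos (Nat.odd_iff.2 hi), if_neg (by omega), Nat.sub_zero]
  · have hr : n % 2 = 1 := Nat.odd_iff.1 hn2
    have hm : (n - 1) / 2 = n / 2 := by omega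
    obtain ⟨⟨l, h1, h2, h3⟩, hlim⟩ := exists_spectrum_and_tendsto hJ ha
    simp only [hr, true_and] at h3 hlim
    rw [hm]
    refine ⟨⟨l, h3, h2, h1⟩, fun l hl H hH hs => ?_⟩
    convert hlim l hl.2.2 hl.1 H hH hs using 4 with i
    rcases Nat.mod_two_eq_zero_or_one i with hi | hi
    · rw [if_pos (Nat.even_iff.2 hi), if_neg (by omega), Nat.add_sub_cancel]
    · rw [if_neg (by rw [Nat.even_iff]; omega), if_pos hi]
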